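/- Let $M$ be a smooth manifold (finite dimensional, Hausdorff, second countable, without boundary), fix a nonstandard extension $A\mapsto{}^*A$ and a positive infinitesimal $\lambda\in{}^*\mathbb R$. For $r,s\in{}^*\mathbb R$ write $r\prec s$ if $r=cs$ for some finite $c\in{}^*\mathbb R$. The halo of $p\in M$ is the intersection of the sets ${}^*U$ over the open $U\ni p$; ${}^{\mathfrak h}M\subseteq{}^*M$, the set of nearstandard points, is the union of all halos, and the standard part of $a\in{}^{\mathfrak h}M$ is the $p$ whose halo contains $a$. A pair $(a,x)$ of nearstandard points is a prevector if ${}^*f(x)-{}^*f(a)\prec\lambda$ for every smooth $f:M\to\mathbb R$. A (global) prevector field is an internal map $F:{}^*M\to{}^*M$ such that $(a,F(a))$ is a prevector for every $a\in{}^{\mathfrak h}M$. A prevector field $F$ is of class $D^1$ if, in every smooth chart around the standard part of $a$, $\|F(a)-a-F(b)+b\|\prec\lambda\|a-b\|$ for all $a,b\in{}^{\mathfrak h}M$ such that $(a,b)$ is a prevector. It is of class $D^2$ if, in every smooth chart around the standard part of $a$, $\|F(a)-F(a+v)-F(a+w)+F(a+v+w)\|\prec\lambda\|v\|\|w\|$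 for all $a\in{}^{\mathfrak h}M$ and all $v,w\in{}^*\mathbb R^n$ with $\|v\|,\|w\|\prec\lambda$. It realizes a classical vector field $X$ on $M$ if for every smooth $h:M\to\mathbb R$ and every $p\in M$ the standard part of $\frac1\lambda\bigl({}^*h(F(p))-h(p)\bigr)$ is $(Xh)(p)$. Let $X$ be a classical vector field of class $C^1$ (resp. $C^2$) on $M$. (1) If the nonstandard extension is countably saturated (every decreasing sequence of nonempty internal sets has nonempty intersection), then there is a global prevector field $F$ on ${}^*M$ of class $D^1$ (resp. $D^1$ and $D^2$) that realizes $X$ and whose values on ${}^{\mathfrak h}M$ are canonically prescribed by $X$: for $a\in{}^{\mathfrak h}M$ with standard part $p$, there is a local flow $\Phi$ of $X$ near $p$ (that is, an open $U\ni p$, a real $T>0$, and, for each $x\in U$, an integral curve $t\mapsto\Phi(t,x)$, $|t|<T$, of $X$ with $\Phi(0,x)=x$), and $F(a)={}^*\Phi(\lambda,a)$ for every such local flow. (2) If $X$ has compact support, then, without assuming saturation, there is exactly one such $F$ (that is, exactly one $F$ with all the properties in (1)) which in addition satisfies $F(a)=a$ for all $a\in{}^*M\setminus{}^{\mathfrak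 h}M$; thus $F$ is canonically prescribed on all of ${}^*M$. -/

import Mathlib

open Set Topology
open scoped Manifold ContDiff

/-- A nonstandard extension, in functorial form: every set `A` is extended to a set `star A`, every
map `f : A → B` to a map `map f : star A → star B`, compatibly with composition, with finite
products and with finite disjoint unions (`pt` is the point of the extension of a singleton).
These laws amount to the transfer principle: extension commutes with all Boolean operations on sets
and relations (`starSet_compl`, `starSet_inter`), with projection along a coordinate, that is, with
quantifiers (`starSet_image`), and with cartesian products and equality (`starSet_diagonal`). The
sets `A` may be power sets and spaces of maps, which gives the internal sets and internal maps. -/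
structure NonstandardExtension where
  star : Type → Type*
  map : ∀ {A B : Type}, (A → B) → star A → star B
  map_id : ∀ (A : Type) (x : star A), map (id : A → A) x = x
  map_comp : ∀ {A B C : Type} (g : B → C) (f : A → B) (x : star A), map (g ∘ f) x = map g (map f x)
  pt : star Unit
  prod_bijective : ∀ A B : Type, Function.Bijective
    (fun z : star (A × B) => ((map Prod.fst z, map Prod.snd z) : star A × star B))
  sum_bijective : ∀ A B : Type, Function.Bijective
    (Sum.elim (map Sum.inl) (map Sum.inr) : star A ⊕ star B → star (A ⊕ B))

namespace NonstandardExtension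

noncomputable section

variable (N : NonstandardExtension) {A B C : Type}

/-- The standard element of `star A` given by `a : A`. -/
def std (a : A) : N.star A := N.map (fun _ => a) N.pt

/-- The identification of `star A × star B` with `star (A × B)`. -/
def pair (x : N.star A) (y : N.star B) : N.star (A × B) :=
  (Equiv.ofBijective _ (N.prod_bijective A B)).symm (x, y)

/-- The extension of a map of two variables. -/
def map₂ (f : A → B → C) (x : N.star A) (y : N.star B) : N.star C :=
  N.map (fun z : A × B => f z.1 z.2) (N.pair x y)

/-- The extension of a subset `S` of `A`, as a subset of `star A`. -/
def starSet (S : Set A) : Set (N.star A) := range (N.map (Subtype.val : S → A))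

/-! ### Compatibility with the logical operations -/

theorem map_pair (x : N.star A) (y : N.star B) :
    N.map Prod.fst (N.pair x y) = x ∧ N.map Prod.snd (N.pair x y) = y := by
  have h := (Equiv.ofBijective _ (N.prod_bijective A B)).apply_symm_apply (x, y)
  exact ⟨congrArg Prod.fst h, congrArg Prod.snd h⟩

theorem isEmpty_star_empty (h : IsEmpty A) : IsEmpty (N.star A) := by
  refine ⟨fun x => ?_⟩
  have h2 : (Sum.inl : A → A ⊕ A) = Sum.inr := funext fun a => h.elim a
  have h3 := @(N.sum_bijective A A).1 (Sum.inl x) (Sum.inr x) (by simp [h2])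
  cases h3

theorem mem_starSet_compl_iff (S : Set A) (x : N.star A) : x ∈ N.starSet Sᶜ ↔ x ∉ N.starSet S := by
  classical
  let e : S ⊕ (Sᶜ : Set A) → A := Sum.elim Subtype.val Subtype.val
  let r : A → S ⊕ (Sᶜ : Set A) := fun a => if h : a ∈ S then Sum.inl ⟨a, h⟩ else Sum.inr ⟨a, h⟩
  have hre : r ∘ e = id := by
    funext z
    rcases z with ⟨a, ha⟩ | ⟨a, ha⟩
    · simp [r, e, ha]
    · have ha' : a ∉ S := ha
      simp [r, e, ha']
  have her : e ∘ r = id := by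
    funext a
    by_cases h : a ∈ S <;> simp [r, e, h]
  have hl : e ∘ Sum.inl = Subtype.val := rfl
  have hr : e ∘ Sum.inr = Subtype.val := rfl
  constructor
  · rintro ⟨y, rfl⟩ ⟨z, hz⟩
    rw [← hl, ← hr, N.map_comp, N.map_comp] at hz
    have h1 := congrArg (N.map r) hz
    rw [← N.map_comp, ← N.map_comp r e, hre, N.map_id, N.map_id] at h1
    have h2 := @(N.sum_bijective S (Sᶜ : Set A)).1 (Sum.inl z) (Sum.inr y) h1
    cases h2
  · intro hx
    obtain ⟨w, hw⟩ := (N.sum_bijective S (Sᶜ : Set A)).2 (N.map r x)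
    have hx2 : N.map e (N.map r x) = x := by rw [← N.map_comp, her, N.map_id]
    rcases w with z | y
    · refine absurd ⟨z, ?_⟩ hx
      rw [← hl, N.map_comp, ← hx2, ← hw]; rfl
    · refine ⟨y, ?_⟩
      rw [← hr, N.map_comp, ← hx2, ← hw]; rfl

theorem starSet_compl (S : Set A) : N.starSet Sᶜ = (N.starSet S)ᶜ :=
  ext fun x => N.mem_starSet_compl_iff S x

theorem starSet_mono {S T : Set A} (h : S ⊆ T) : N.starSet S ⊆ N.starSet T := by
  rintro _ ⟨y, rfl⟩
  exact ⟨N.map (inclusion h) y, by rw [← N.map_comp]; rfl⟩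

theorem starSet_image (f : A → B) (S : Set A) : N.starSet (f '' S) = N.map f '' N.starSet S := by
  apply Subset.antisymm
  · rintro _ ⟨y, rfl⟩
    choose g hg using fun b : f '' S => b.2
    refine ⟨N.map g y, ⟨N.map (fun b => (⟨g b, (hg b).1⟩ : S)) y, ?_⟩, ?_⟩
    · rw [← N.map_comp]; rfl
    · rw [← N.map_comp]
      exact congrArg (fun k => N.map k y) (funext fun b => (hg b).2)
  · rintro _ ⟨_, ⟨y, rfl⟩, rfl⟩
    refine ⟨N.map (fun a : S => (⟨f a, mem_image_of_mem f a.2⟩ : f '' S)) y, ?_⟩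
    rw [← N.map_comp, ← N.map_comp]; rfl

theorem mem_starSet_preimage (f : A → B) (S : Set B) (x : N.star A) :
    x ∈ N.starSet (f ⁻¹' S) ↔ N.map f x ∈ N.starSet S := by
  have key : ∀ S : Set B, x ∈ N.starSet (f ⁻¹' S) → N.map f x ∈ N.starSet S := fun S hx =>
    N.starSet_mono (image_preimage_subset f S) (by rw [N.starSet_image]; exact ⟨x, hx, rfl⟩)
  refine ⟨key S, fun h => ?_⟩
  by_contra hx
  rw [← mem_starSet_compl_iff, ← preimage_compl] at hx
  exact (N.mem_starSet_compl_iff S _).1 (key _ hx) h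

theorem starSet_inter (S T : Set A) : N.starSet (S ∩ T) = N.starSet S ∩ N.starSet T := by
  apply Subset.antisymm
    (subset_inter (N.starSet_mono inter_subset_left) (N.starSet_mono inter_subset_right))
  rintro _ ⟨⟨y, rfl⟩, hT⟩
  rw [← mem_starSet_preimage] at hT
  have h := N.starSet_image (Subtype.val : S → A) (Subtype.val ⁻¹' T)
  rw [Subtype.image_preimage_coe] at h
  rw [h]
  exact ⟨y, hT, rfl⟩

theorem starSet_diagonal :
    N.starSet {z : A × A | z.1 = z.2} = {z | N.map Prod.fst z = N.map Prod.snd z} := by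
  apply Subset.antisymm
  · rintro _ ⟨y, rfl⟩
    change N.map _ _ = N.map _ _
    rw [← N.map_comp, ← N.map_comp]
    exact congrArg (fun k => N.map k y) (funext fun w => w.2)
  · intro z hz
    have h : N.map (fun a : A => (a, a)) (N.map Prod.fst z) = z := by
      apply (N.prod_bijective A A).1
      simp only [← N.map_comp, Prod.mk.injEq]
      exact ⟨rfl, hz⟩
    refine ⟨N.map (fun a : A => (⟨(a, a), rfl⟩ : {z : A × A | z.1 = z.2})) (N.map Prod.fst z), ?_⟩
    rw [← N.map_comp]
    exact h

/-! ### Internal objects, saturation, halos, finite hyperreals -/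

/-- The internal sets are the elements of the extension of a power set. -/
def IsInternalSet (S : Set (N.star A)) : Prop :=
  ∃ s : N.star (Set A), ∀ x, x ∈ S ↔ N.pair x s ∈ N.starSet {z : A × Set A | z.1 ∈ z.2}

/-- The internal maps are the elements of the extension of a space of maps. -/
def IsInternalMap (F : N.star A → N.star B) : Prop :=
  ∃ f : N.star (A → B), ∀ x, F x = N.map₂ (fun (g : A → B) a => g a) f x

/-- Countable saturation: a decreasing sequence of nonempty internal sets has nonempty
intersection. -/
def CountablySaturated : Prop :=
  ∀ (A : Type) (S : ℕ → Set (N.star A)), (∀ n, N.IsInternalSet (S n)) → (∀ n, (S n).Nonempty) →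
    (∀ n, S (n + 1) ⊆ S n) → (⋂ n, S n).Nonempty

/-- The halo (monad) of a point of a topological space. -/
def halo [TopologicalSpace A] (p : A) : Set (N.star A) :=
  {x | ∀ U : Set A, IsOpen U → p ∈ U → x ∈ N.starSet U}

/-- The set of nearstandard points of the extension of a topological space. -/
def nearstandard (A : Type) [TopologicalSpace A] : Set (N.star A) := ⋃ p : A, N.halo p

instance [Add A] : Add (N.star A) := ⟨N.map₂ (· + ·)⟩
instance [Sub A] : Sub (N.star A) := ⟨N.map₂ (· - ·)⟩
instance [Mul A] : Mul (N.star A) := ⟨N.map₂ (· * ·)⟩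
instance [Div A] : Div (N.star A) := ⟨N.map₂ (· / ·)⟩

/-- The extension of the norm, with values in the hyperreals. -/
def norm [Norm A] (x : N.star A) : N.star ℝ := N.map (fun a : A => ‖a‖) x

def IsFinite (r : N.star ℝ) : Prop := ∃ K : ℝ, r ∈ N.starSet {x : ℝ | |x| ≤ K}

/-- `r ≺ s`: the hyperreal `r` is a finite multiple of `s`. -/
def Prec (r s : N.star ℝ) : Prop := ∃ c, N.IsFinite c ∧ r = c * s

def IsPosInfinitesimal (r : N.star ℝ) : Prop := r ∈ N.starSet (Ioi 0) ∧ r ∈ N.halo (0 : ℝ)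

/-! ### Prevector fields -/

section Manifold

variable {n : ℕ} {M : Type} [TopologicalSpace M] [ChartedSpace (EuclideanSpace ℝ (Fin n)) M]
variable (n) (lam : N.star ℝ)

/-- `(a, x)` is a prevector based at `a`, at the infinitesimal scale `lam`. -/
def IsPrevector (a x : N.star M) : Prop :=
  a ∈ N.nearstandard M ∧ x ∈ N.nearstandard M ∧
    ∀ f : M → ℝ, ContMDiff (𝓡 n) 𝓘(ℝ, ℝ) ∞ f → N.Prec (N.map f x - N.map f a) lam

/-- `F` is a (global) prevector field on `star M`. -/
def IsPrevectorField (F : N.star M → N.star M) : Prop :=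
  N.IsInternalMap F ∧ ∀ a ∈ N.nearstandard M, N.IsPrevector n lam a (F a)

/-- The prevector field `F` is of class `D¹`; the condition is required in every smooth chart `φ`
around the standard part `p` of the point `a`. -/
def IsD1 (F : N.star M → N.star M) : Prop :=
  N.IsPrevectorField n lam F ∧
    ∀ (p : M), ∀ φ ∈ IsManifold.maximalAtlas (𝓡 n) ∞ M, p ∈ φ.source →
      ∀ a ∈ N.halo p, ∀ b ∈ N.nearstandard M, N.IsPrevector n lam a b →
        N.Prec (N.norm (N.map φ (F a) - N.map φ a - N.map φ (F b) + N.map φ b))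
          (lam * N.norm (N.map φ a - N.map φ b))

/-- The prevector field `F` is of class `D²`; the condition is required in every smooth chart `φ`
around the standard part `p` of the point `a`, and `G` is the coordinate expression of `F`. -/
def IsD2 (F : N.star M → N.star M) : Prop :=
  N.IsPrevectorField n lam F ∧
    ∀ (p : M), ∀ φ ∈ IsManifold.maximalAtlas (𝓡 n) ∞ M, p ∈ φ.source →
      ∀ a ∈ N.halo p, ∀ v w : N.star (EuclideanSpace ℝ (Fin n)),
        N.Prec (N.norm v) lam → N.Prec (N.norm w) lam →
        let x := N.map φ a
        let G := fun y : N.star (EuclideanSpace ℝ (Fin n)) => N.map φ (F (N.map φ.symm y))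
        N.Prec (N.norm (G x - G (x + v) - G (x + w) + G (x + v + w)))
          (lam * N.norm v * N.norm w)

variable {n}

/-- `F` realizes the classical vector field `X`: at each standard point `p`, for each smooth
function `h`, the standard part of `(h (F p) - h p) / lam` is the derivative of `h` along `X`. -/
def Realizes (F : N.star M → N.star M) (X : ∀ x : M, TangentSpace (𝓡 n) x) : Prop :=
  ∀ (p : M) (h : M → ℝ), ContMDiff (𝓡 n) 𝓘(ℝ, ℝ) ∞ h →
    (N.map h (F (N.std p)) - N.map h (N.std p)) / lam ∈
      N.halo (A := ℝ) (mfderiv (𝓡 n) 𝓘(ℝ, ℝ) h p (X p))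

end Manifold

end

end NonstandardExtension

/-- `Φ t x`, for `|t| < T` and `x ∈ U`, is a local flow of the vector field `X`. -/
structure IsLocalFlow {n : ℕ} {M : Type} [TopologicalSpace M]
    [ChartedSpace (EuclideanSpace ℝ (Fin n)) M] (X : ∀ x : M, TangentSpace (𝓡 n) x)
    (U : Set M) (T : ℝ) (Φ : ℝ → M → M) : Prop where
  isOpen : IsOpen U
  pos : 0 < T
  zero : ∀ x ∈ U, Φ 0 x = x
  integralCurve : ∀ x ∈ U, IsMIntegralCurveOn (fun t => Φ t x) X (Ioo (-T) T)

/-- The canonical values on the nearstandard points: `F a` is the value at `(lam, a)` of the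
extension of any local flow of `X` around the standard part `p` of `a`, and there is such a flow. -/
def NonstandardExtension.IsCanonicalOnNearstandard (N : NonstandardExtension) (lam : N.star ℝ)
    {n : ℕ} {M : Type} [TopologicalSpace M] [ChartedSpace (EuclideanSpace ℝ (Fin n)) M]
    (X : ∀ x : M, TangentSpace (𝓡 n) x) (F : N.star M → N.star M) : Prop :=
  ∀ (p : M), ∀ a ∈ N.halo p,
    (∃ U T Φ, IsLocalFlow X U T Φ ∧ p ∈ U) ∧
      ∀ U T Φ, IsLocalFlow X U T Φ → p ∈ U → F a = N.map₂ Φ lam a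

/-! The field is the extension of one standard map, evaluated at infinitesimal time: `F = N.map₂
(maximalFlow X) lam`. Since `maximalFlow X` is total on `ℝ × M` (it fixes `x` when no symmetric
integral curve reaches time `t`), `F` is defined on all of `star M` and is internal
(`isInternalMap_map₂`). Uniqueness of integral curves (`maximalFlow_eq`) makes it agree near `(0,
p)` with every local flow.

Every relation `≺` comes from a real inequality with one constant `C`, valid on a neighbourhood of a
standard point. The hyperreal data are gathered into a single point `z` of the extension of a
product (`exists_map_fst_snd`), each expression becomes `N.map` of one function at `z`, and
`prec_map_map` converts the inequality. The real inequalities are ODE estimates in a chart, with a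
factor `t` that becomes `lam`: Grönwall and the mean value inequality give first differences
(`norm_sub_sub_add_le_of_trajectories`) and second differences
(`exists_second_difference_le_of_trajectories`).

If `X` has compact support, a point that is not nearstandard lies outside the extension of the
support, where the flow is the identity. Nearstandard values are forced by local flows, hence
uniqueness. -/

namespace NonstandardExtension

/-! ### Transfer -/

section Transfer

variable (N : NonstandardExtension) {A B C D : Type}

theorem map_congr_of_mem {f g : A → B} {S : Set A} {x : N.star A} (hx : x ∈ N.starSet S)
    (h : ∀ a ∈ S, f a = g a) : N.map f x = N.map g x := by
  obtain ⟨y, rfl⟩ := hx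
  rw [← N.map_comp, ← N.map_comp]
  exact congrArg (fun k => N.map k y) (funext fun a => h a a.2)

theorem mem_starSet_univ (x : N.star A) : x ∈ N.starSet (univ : Set A) :=
  ⟨N.map (fun a => ⟨a, mem_univ a⟩) x, by rw [← N.map_comp]; exact N.map_id A x⟩

theorem pair_ext {z w : N.star (A × B)} (h₁ : N.map Prod.fst z = N.map Prod.fst w)
    (h₂ : N.map Prod.snd z = N.map Prod.snd w) : z = w :=
  (N.prod_bijective A B).1 (Prod.ext h₁ h₂)

theorem exists_map_fst_snd (x : N.star A) (y : N.star B) :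
    ∃ z : N.star (A × B), N.map Prod.fst z = x ∧ N.map Prod.snd z = y :=
  ⟨N.pair x y, N.map_pair x y⟩

theorem pair_map_map (f : A → B) (g : A → C) (z : N.star A) :
    N.pair (N.map f z) (N.map g z) = N.map (fun a => (f a, g a)) z := by
  apply N.pair_ext
  · rw [(N.map_pair _ _).1, ← N.map_comp]; rfl
  · rw [(N.map_pair _ _).2, ← N.map_comp]; rfl

theorem map₂_map_map (k : B → C → D) (f : A → B) (g : A → C) (z : N.star A) :
    N.map₂ k (N.map f z) (N.map g z) = N.map (fun a => k (f a) (g a)) z := by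
  rw [map₂, pair_map_map, ← N.map_comp]; rfl

theorem map_add_map [Add B] (f g : A → B) (z : N.star A) :
    N.map f z + N.map g z = N.map (fun a => f a + g a) z := N.map₂_map_map _ f g z

theorem map_sub_map [Sub B] (f g : A → B) (z : N.star A) :
    N.map f z - N.map g z = N.map (fun a => f a - g a) z := N.map₂_map_map _ f g z

theorem map_mul_map [Mul B] (f g : A → B) (z : N.star A) :
    N.map f z * N.map g z = N.map (fun a => f a * g a) z := N.map₂_map_map _ f g z

theorem map_div_map [Div B] (f g : A → B) (z : N.star A) :
    N.map f z / N.map g z = N.map (fun a => f a / g a) z := N.map₂_map_map _ f g z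

theorem norm_map [Norm B] (f : A → B) (z : N.star A) :
    N.norm (N.map f z) = N.map (fun a => ‖f a‖) z := (N.map_comp _ f z).symm

theorem map_map (g : B → C) (f : A → B) (z : N.star A) :
    N.map g (N.map f z) = N.map (fun a => g (f a)) z := (N.map_comp g f z).symm

/-- The two projections of `Unit × Unit` are the same map, so a point of its extension has equal
coordinates. -/
theorem star_unit_eq (x y : N.star Unit) : x = y := by
  obtain ⟨z, rfl, rfl⟩ := N.exists_map_fst_snd x y
  rfl

theorem map_const (b : B) (z : N.star A) : N.map (fun _ => b) z = N.std b := by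
  rw [std, N.star_unit_eq N.pt (N.map (fun _ => ()) z), map_map]

/-! ### Halos -/

variable [TopologicalSpace A] [TopologicalSpace B]

theorem mem_starSet_of_eventually {x : N.star A} {p : A} (hx : x ∈ N.halo p) {P : A → Prop}
    (h : ∀ᶠ a in 𝓝 p, P a) : x ∈ N.starSet {a | P a} := by
  obtain ⟨U, hU, hUo, hpU⟩ := eventually_nhds_iff.1 h
  exact N.starSet_mono hU (hx U hUo hpU)

theorem map_mem_halo {x : N.star A} {p : A} (hx : x ∈ N.halo p) {f : A → B}
    (hf : ContinuousAt f p) : N.map f x ∈ N.halo (f p) := by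
  intro U hU hp
  rw [← mem_starSet_preimage]
  exact N.mem_starSet_of_eventually hx (hf (hU.mem_nhds hp))

theorem mem_halo_prod {z : N.star (A × B)} {p : A} {q : B} (h₁ : N.map Prod.fst z ∈ N.halo p)
    (h₂ : N.map Prod.snd z ∈ N.halo q) : z ∈ N.halo (p, q) := by
  intro U hU hp
  obtain ⟨V, W, hV, hW, hpV, hqW, hVW⟩ := isOpen_prod_iff.1 hU p q hp
  refine N.starSet_mono hVW ?_
  rw [prod_eq, starSet_inter]
  exact ⟨(N.mem_starSet_preimage _ _ _).2 (h₁ V hV hpV),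
    (N.mem_starSet_preimage _ _ _).2 (h₂ W hW hqW)⟩

theorem halo_subset_nearstandard (p : A) : N.halo p ⊆ N.nearstandard A :=
  subset_iUnion (fun p => N.halo p) p

/-- Robinson's criterion. If `x` is in no halo, each `p` has an open neighbourhood whose extension
misses `x`; finitely many of them cover `K`, and extension commutes with finite unions. -/
theorem starSet_subset_nearstandard_of_isCompact {K : Set A} (hK : IsCompact K) :
    N.starSet K ⊆ N.nearstandard A := by
  intro x hxK
  by_contra hx
  simp only [nearstandard, mem_iUnion, not_exists, halo, mem_ofPred_eq, not_forall] at hx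
  choose U hU hpU hxU using hx
  obtain ⟨t, ht⟩ := hK.elim_finite_subcover U hU fun p _ => mem_iUnion.2 ⟨p, hpU p⟩
  have key : ∀ s : Finset A, x ∈ N.starSet (⋂ p ∈ s, (U p)ᶜ) := by
    classical
    intro s
    induction s using Finset.induction_on with
    | empty => simpa using N.mem_starSet_univ x
    | insert p s _ ih =>
      rw [Finset.set_biInter_insert, starSet_inter, starSet_compl]
      exact ⟨hxU p, ih⟩
  have h₁ : x ∈ N.starSet (⋃ p ∈ t, U p) := N.starSet_mono ht hxK
  have h₂ := key t
  rw [← compl_iUnion₂, starSet_compl] at h₂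
  exact h₂ h₁

/-- Curried, `Φ` extends to `star A → star (B → C)`; its value at `x` represents the map. -/
theorem isInternalMap_map₂ {A B C : Type} (Φ : A → B → C) (x : N.star A) :
    N.IsInternalMap (N.map₂ Φ x) := by
  refine ⟨N.map Φ x, fun y => ?_⟩
  obtain ⟨z, rfl, rfl⟩ := N.exists_map_fst_snd x y
  rw [map₂_map_map, map_map, map₂_map_map]

end Transfer

/-! ### Finite multiples and infinitesimals -/

section Prec

variable (N : NonstandardExtension) {A : Type}

/-- The finite factor is the quotient `u / v`, bounded by `|C|`. Where `v` vanishes so does `u`, so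
the convention for division by zero is harmless. -/
theorem prec_map_map {u v : A → ℝ} {C : ℝ} {z : N.star A}
    (h : z ∈ N.starSet {a | |u a| ≤ C * |v a|}) : N.Prec (N.map u z) (N.map v z) := by
  refine ⟨N.map (fun a => u a / v a) z, ⟨|C|, ?_⟩, ?_⟩
  · rw [← mem_starSet_preimage]
    refine N.starSet_mono (fun a (ha : |u a| ≤ C * |v a|) => ?_) h
    change |u a / v a| ≤ |C|
    rw [abs_div]
    exact div_le_of_le_mul₀ (abs_nonneg _) (abs_nonneg _)
      (ha.trans (mul_le_mul_of_nonneg_right (le_abs_self C) (abs_nonneg _)))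
  · rw [map_mul_map]
    refine N.map_congr_of_mem h fun a ha => ?_
    by_cases hv : v a = 0
    · have : |u a| ≤ 0 := by simpa [hv] using ha
      simp [hv, abs_nonpos_iff.1 this]
    · field_simp

theorem Prec.mem_halo_zero {r s : N.star ℝ} (h : N.Prec r s) (hs : s ∈ N.halo (0 : ℝ)) :
    r ∈ N.halo (0 : ℝ) := by
  obtain ⟨c, ⟨K, hK⟩, rfl⟩ := h
  obtain ⟨z, rfl, rfl⟩ := N.exists_map_fst_snd c s
  intro U hU h0
  obtain ⟨δ, hδ, hδU⟩ := Metric.isOpen_iff.1 hU 0 h0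
  have hs' := N.mem_starSet_of_eventually hs
    (Metric.ball_mem_nhds (0 : ℝ) (show 0 < δ / (|K| + 1) by positivity))
  rw [← mem_starSet_preimage] at hK
  rw [← mem_starSet_preimage] at hs'
  rw [map_mul_map, ← mem_starSet_preimage]
  have hmem : z ∈ N.starSet _ := (N.starSet_inter _ _).superset ⟨hK, hs'⟩
  refine N.starSet_mono ?_ hmem
  rintro w ⟨hw, hw'⟩
  have hw₁ : |w.1| ≤ |K| := (show |w.1| ≤ K from hw).trans (le_abs_self K)
  have hw₂ : |w.2| < δ / (|K| + 1) := by simpa using hw'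
  refine hδU ?_
  rw [mem_ball_zero_iff, Real.norm_eq_abs, abs_mul]
  calc |w.1| * |w.2| ≤ (|K| + 1) * |w.2| := by gcongr; linarith
    _ < (|K| + 1) * (δ / (|K| + 1)) := by gcongr
    _ = δ := by field_simp

theorem mem_halo_zero_of_norm {E : Type} [NormedAddCommGroup E] {v : N.star E}
    (h : N.norm v ∈ N.halo (0 : ℝ)) : v ∈ N.halo (0 : E) := by
  intro U hU h0
  obtain ⟨δ, hδ, hδU⟩ := Metric.isOpen_iff.1 hU 0 h0
  have := N.mem_starSet_of_eventually h (Metric.ball_mem_nhds (0 : ℝ) hδ)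
  rw [norm, ← mem_starSet_preimage] at this
  exact N.starSet_mono (fun w hw => hδU (by simpa using hw)) this

end Prec

end NonstandardExtension

/-! ### Estimates for trajectories of an autonomous differential equation -/

section ODE

variable {E : Type*} [NormedAddCommGroup E] [NormedSpace ℝ E]

/-- Local solutions of an autonomous equation with Lipschitz right-hand side, on a common time
interval and with values in a prescribed neighbourhood. -/
theorem exists_trajectories_mem_of_contDiffAt [CompleteSpace E] {f : E → E} {y₀ : E}
    (hf : ContDiffAt ℝ 1 f y₀) {s : Set E} (hs : s ∈ 𝓝 y₀) :
    ∃ r > (0 : ℝ), ∃ ε > (0 : ℝ), ∀ y ∈ Metric.ball y₀ r, ∃ α : ℝ → E, α 0 = y ∧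
      ∀ t ∈ Ioo (-ε) ε, α t ∈ s ∧ HasDerivAt α (f (α t)) t := by
  obtain ⟨ε, hε, a, r, L, K, hr, hpl⟩ := IsPicardLindelof.of_contDiffAt_one hf
  obtain ⟨b, hb, hbs⟩ := Metric.nhds_basis_closedBall.mem_iff.1 hs
  -- The Picard–Lindelöf inequality has a nonnegative left side and right side `a - r`, so `a ≥ r >
  -- 0`.
  have ha : 0 < a := by
    have h := (hpl 0).mul_max_le
    have h0 : (0 : ℝ) ≤ (L : ℝ) * max (0 + ε - 0) (0 - (0 - ε)) :=
      mul_nonneg L.2 (le_max_of_le_left (by linarith))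
    have : (r : ℝ) ≤ a := by simpa using h0.trans h
    exact_mod_cast lt_of_lt_of_le (show (0 : ℝ) < r from hr) this
  lift b to NNReal using hb.le
  have hc : 0 < min a b := lt_min ha (by exact_mod_cast hb)
  -- A shorter time interval confines the solutions to the ball of radius `min a b`, which lies in
  -- `s`; initial values are taken in the ball of half that radius.
  obtain ⟨ε', hε', hpl'⟩ := (hpl 0).exists_shrink_radius hε (a' := min a b) (r' := min a b / 2)
    (min_le_left _ _) (NNReal.half_lt_self hc.ne')
  refine ⟨(min a b / 2 : NNReal), by exact_mod_cast half_pos hc, ε', hε', fun y hy => ?_⟩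
  obtain ⟨α, hα⟩ := ODE.FunSpace.exists_isFixedPt_next hpl' (Metric.ball_subset_closedBall hy)
  have hmem : ∀ t, α.compProj t ∈ Metric.closedBall y₀ (min a b : NNReal) := fun t =>
    α.compProj_mem_closedBall hpl'.mul_max_le
  refine ⟨α.compProj, ?_, fun t ht => ⟨hbs (Metric.closedBall_subset_closedBall
    (by exact_mod_cast min_le_right a b) (hmem t)), ?_⟩⟩
  · have := ODE.FunSpace.compProj_val (α := α) (t := ⟨0, by simp [hε'.le]⟩)
    rw [this, ← hα, ODE.FunSpace.next_apply₀]
  · have ht' : t ∈ Icc (0 - ε') (0 + ε') := by simpa using Ioo_subset_Icc_self ht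
    refine HasDerivWithinAt.hasDerivAt (s := Icc (0 - ε') (0 + ε')) ?_
      (Icc_mem_nhds (by simpa using ht.1) (by simpa using ht.2))
    refine (ODE.hasDerivWithinAt_picard_Icc (f := fun _ => f) (t₀ := 0) (by simp [hε'.le])
      hpl'.continuousOn_uncurry α.continuous_compProj.continuousOn (fun _ _ => hmem _)
      y ht').congr_of_mem (fun t' ht' => ?_) ht'
    nth_rw 1 [← hα]
    rw [ODE.FunSpace.compProj_of_mem ht', ODE.FunSpace.next_apply]

variable {f : E → E} {s : Set E} {ε : ℝ}

theorem norm_sub_le_of_trajectories {K : NNReal} (hf : LipschitzOnWith K f s) {g h : ℝ → E}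
    (hg : ∀ t ∈ Ioo (-ε) ε, g t ∈ s ∧ HasDerivAt g (f (g t)) t)
    (hh : ∀ t ∈ Ioo (-ε) ε, h t ∈ s ∧ HasDerivAt h (f (h t)) t) {t : ℝ} (ht : t ∈ Ico 0 ε) :
    ‖g t - h t‖ ≤ ‖g 0 - h 0‖ * Real.exp (K * ε) := by
  have hI : ∀ u ∈ Icc 0 t, u ∈ Ioo (-ε) ε := fun u hu =>
    ⟨by linarith [hu.1, ht.1, ht.2], hu.2.trans_lt ht.2⟩
  have key := dist_le_of_trajectories_ODE_of_mem (v := fun _ => f) (s := fun _ => s) (K := K)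
    (f := g) (g := h) (a := 0) (b := t) (δ := ‖g 0 - h 0‖) (fun _ _ => hf)
    (fun u hu => (hg u (hI u hu)).2.continuousAt.continuousWithinAt)
    (fun u hu => (hg u (hI u (Ico_subset_Icc_self hu))).2.hasDerivWithinAt)
    (fun u hu => (hg u (hI u (Ico_subset_Icc_self hu))).1)
    (fun u hu => (hh u (hI u hu)).2.continuousAt.continuousWithinAt)
    (fun u hu => (hh u (hI u (Ico_subset_Icc_self hu))).2.hasDerivWithinAt)
    (fun u hu => (hh u (hI u (Ico_subset_Icc_self hu))).1) (dist_eq_norm _ _).le t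
    (right_mem_Icc.2 ht.1)
  rw [dist_eq_norm] at key
  refine key.trans ?_
  gcongr
  linarith [ht.2]

/-- By Grönwall, `g - h` has derivative of norm at most `K * exp (K * ε) * ‖g 0 - h 0‖`; the mean
value inequality on `[0, t]` supplies the factor `t`. -/
theorem norm_sub_sub_add_le_of_trajectories {K : NNReal} (hf : LipschitzOnWith K f s)
    {g h : ℝ → E} (hg : ∀ t ∈ Ioo (-ε) ε, g t ∈ s ∧ HasDerivAt g (f (g t)) t)
    (hh : ∀ t ∈ Ioo (-ε) ε, h t ∈ s ∧ HasDerivAt h (f (h t)) t) {t : ℝ} (ht : t ∈ Ico 0 ε) :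
    ‖g t - g 0 - h t + h 0‖ ≤ K * Real.exp (K * ε) * (t * ‖g 0 - h 0‖) := by
  have hI : ∀ u ∈ Icc 0 t, u ∈ Ioo (-ε) ε := fun u hu =>
    ⟨by linarith [hu.1, ht.1, ht.2], hu.2.trans_lt ht.2⟩
  have key := (convex_Icc (0 : ℝ) t).norm_image_sub_le_of_norm_hasDerivWithin_le
    (f := fun u => g u - h u) (f' := fun u => f (g u) - f (h u))
    (C := K * (‖g 0 - h 0‖ * Real.exp (K * ε)))
    (fun u hu => ((hg u (hI u hu)).2.sub (hh u (hI u hu)).2).hasDerivWithinAt)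
    (fun u hu => (hf.norm_sub_le (hg u (hI u hu)).1 (hh u (hI u hu)).1).trans
      (mul_le_mul_of_nonneg_left
        (norm_sub_le_of_trajectories hf hg hh ⟨hu.1, hu.2.trans_lt ht.2⟩) K.2))
    (left_mem_Icc.2 ht.1) (right_mem_Icc.2 ht.1)
  have e : g t - g 0 - h t + h 0 = g t - h t - (g 0 - h 0) := by abel
  rw [e]
  refine key.trans (le_of_eq ?_)
  rw [sub_zero, Real.norm_of_nonneg ht.1]
  ring

/-- Mean value inequality for `x ↦ f (x + q) - f x` from `a` to `a + p`: its derivative is bounded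
by `K * ‖q‖`. -/
theorem norm_second_difference_le {f' : E → E →L[ℝ] E} {K : NNReal} (hs : Convex ℝ s)
    (hf : ∀ x ∈ s, HasFDerivAt f (f' x) x) (hf' : LipschitzOnWith K f' s) {a p q : E}
    (ha : a ∈ s) (hp : a + p ∈ s) (hq : a + q ∈ s) (hpq : a + p + q ∈ s) :
    ‖f a - f (a + p) - f (a + q) + f (a + p + q)‖ ≤ K * ‖p‖ * ‖q‖ := by
  have hc : Convex ℝ (s ∩ (fun x => x + q) ⁻¹' s) := by
    refine hs.inter fun x hx y hy b c hb hc hbc => ?_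
    have : b • x + c • y + q = b • (x + q) + c • (y + q) := by
      rw [smul_add, smul_add, add_add_add_comm, ← add_smul, hbc, one_smul]
    rw [mem_preimage, this]
    exact hs hx hy hb hc hbc
  have key := hc.norm_image_sub_le_of_norm_hasFDerivWithin_le
    (f := fun x => f (x + q) - f x) (f' := fun x => f' (x + q) - f' x) (C := K * ‖q‖)
    (x := a) (y := a + p)
    (fun x hx => by
      have h₁ : HasFDerivAt (fun x => f (x + q)) (f' (x + q)) x := (hasFDerivAt_comp_add_right q).2 (hf _ hx.2)
      exact (h₁.sub (hf x hx.1)).hasFDerivWithinAt)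
    (fun x hx => by simpa using hf'.norm_sub_le hx.2 hx.1) ⟨ha, hq⟩ ⟨hp, hpq⟩
  have e : f a - f (a + p) - f (a + q) + f (a + p + q) =
      f (a + p + q) - f (a + p) - (f (a + q) - f a) := by abel
  rw [e]
  refine key.trans (le_of_eq ?_)
  rw [add_sub_cancel_left]
  ring

/-- The bound starts at `0` and has derivative `δ * exp (K * u)`, hence is linear in `t` and `δ`
with a constant depending on neither. -/
theorem exists_gronwallBound_zero_le (K ε : ℝ) (hK : 0 ≤ K) :
    ∃ C, ∀ δ ≥ 0, ∀ t ∈ Ico 0 ε, gronwallBound 0 K δ t ≤ C * (t * δ) := by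
  refine ⟨Real.exp (K * ε), fun δ hδ t ht => ?_⟩
  have key := (convex_Icc (0 : ℝ) t).norm_image_sub_le_of_norm_hasDerivWithin_le
    (f := gronwallBound 0 K δ) (f' := fun u => K * gronwallBound 0 K δ u + δ)
    (C := δ * Real.exp (K * ε))
    (fun u _ => (hasDerivAt_gronwallBound 0 K δ u).hasDerivWithinAt)
    (fun u hu => by
      have e : K * gronwallBound 0 K δ u + δ = δ * Real.exp (K * u) := by
        by_cases h : K = 0
        · simp [h]
        · rw [gronwallBound_of_K_ne_0 h]; field_simp; ring
      rw [e, Real.norm_of_nonneg (by positivity)]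
      gcongr
      exact hu.2.trans ht.2.le)
    (left_mem_Icc.2 ht.1) (right_mem_Icc.2 ht.1)
  rw [gronwallBound_x0, sub_zero, sub_zero, Real.norm_of_nonneg ht.1] at key
  calc _ ≤ _ := le_abs_self _
    _ ≤ _ := key
    _ = _ := by ring

/-- The four curves start at the vertices of a parallelogram. Later, `g 3` is compared with the
fourth vertex `a + p + q` spanned by the other three: the derivative of the alternating sum `D` is
at most `L * ‖D‖` plus a second difference of `f` of order `‖p‖ * ‖q‖`. Grönwall with `D = 0` at
time `0` concludes. -/
theorem exists_second_difference_le_of_trajectories {f' : E → E →L[ℝ] E} {K L : NNReal}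
    {y₀ : E} {r : ℝ}
    (hL : LipschitzOnWith L f (Metric.ball y₀ r))
    (hf : ∀ x ∈ Metric.ball y₀ r, HasFDerivAt f (f' x) x)
    (hf' : LipschitzOnWith K f' (Metric.ball y₀ r)) :
    ∃ C, ∀ g : Fin 4 → ℝ → E,
      (∀ i, ∀ t ∈ Ioo (-ε) ε, g i t ∈ Metric.ball y₀ (r / 3) ∧
        HasDerivAt (g i) (f (g i t)) t) →
      g 0 0 - g 1 0 - g 2 0 + g 3 0 = 0 → ∀ t ∈ Ico 0 ε,
      ‖g 0 t - g 1 t - g 2 t + g 3 t‖ ≤ C * (t * ‖g 0 0 - g 1 0‖ * ‖g 0 0 - g 2 0‖) := by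
  obtain ⟨C, hC⟩ := exists_gronwallBound_zero_le L ε L.2
  refine ⟨C * (K * (Real.exp (L * ε) * Real.exp (L * ε))), fun g hg h0 t ht => ?_⟩
  have hI : ∀ u ∈ Icc 0 t, u ∈ Ioo (-ε) ε := fun u hu =>
    ⟨by linarith [hu.1, ht.1, ht.2], hu.2.trans_lt ht.2⟩
  have hD : ∀ u ∈ Icc 0 t, HasDerivAt (fun u => g 0 u - g 1 u - g 2 u + g 3 u)
      (f (g 0 u) - f (g 1 u) - f (g 2 u) + f (g 3 u)) u := fun u hu =>
    ((((hg 0 u (hI u hu)).2.sub (hg 1 u (hI u hu)).2).sub (hg 2 u (hI u hu)).2).add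
      (hg 3 u (hI u hu)).2)
  have hb : ∀ i, ∀ u ∈ Icc 0 t, g i u ∈ Metric.ball y₀ r ∧ ‖g i u - y₀‖ < r / 3 := by
    intro i u hu
    have h : ‖g i u - y₀‖ < r / 3 := by simpa [dist_eq_norm] using (hg i u (hI u hu)).1
    refine ⟨?_, h⟩
    rw [Metric.mem_ball, dist_eq_norm]
    linarith [norm_nonneg (g i u - y₀)]
  have hgL : ∀ i, ∀ t ∈ Ioo (-ε) ε, g i t ∈ Metric.ball y₀ r ∧
      HasDerivAt (g i) (f (g i t)) t := fun i t ht => by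
    refine ⟨?_, (hg i t ht).2⟩
    have h : ‖g i t - y₀‖ < r / 3 := by simpa [dist_eq_norm] using (hg i t ht).1
    rw [Metric.mem_ball, dist_eq_norm]
    linarith [norm_nonneg (g i t - y₀)]
  set δ := K * (‖g 0 0 - g 1 0‖ * Real.exp (L * ε)) * (‖g 0 0 - g 2 0‖ * Real.exp (L * ε)) with hδ
  have key := norm_le_gronwallBound_of_norm_deriv_right_le (δ := 0) (K := L) (ε := δ)
    (fun u hu => (hD u hu).continuousAt.continuousWithinAt)
    (fun u hu => (hD u (Ico_subset_Icc_self hu)).hasDerivWithinAt) (by rw [h0, norm_zero])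
    (fun u hu => by
      replace hu := Ico_subset_Icc_self hu
      have hu' : u ∈ Ico 0 ε := ⟨hu.1, hu.2.trans_lt ht.2⟩
      set a := g 0 u with ha
      set p := g 1 u - g 0 u with hp
      set q := g 2 u - g 0 u with hq
      have hp' : a + p = g 1 u := by simp [ha, hp]
      have hq' : a + q = g 2 u := by simp [ha, hq]
      -- The offset from `y₀` is a signed sum of three offsets below `r / 3`.
      have hpq : a + p + q ∈ Metric.ball y₀ r := by
        rw [Metric.mem_ball, dist_eq_norm]
        have : a + p + q - y₀ = (g 1 u - y₀) + (g 2 u - y₀) - (g 0 u - y₀) := by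
          simp only [ha, hp, hq]; abel
        rw [this]
        have h₁ := norm_sub_le ((g 1 u - y₀) + (g 2 u - y₀)) (g 0 u - y₀)
        have h₂ := norm_add_le (g 1 u - y₀) (g 2 u - y₀)
        linarith [(hb 0 u hu).2, (hb 1 u hu).2, (hb 2 u hu).2]
      have h₁ := norm_second_difference_le (convex_ball y₀ r) hf hf' (hb 0 u hu).1
        (hp'.symm ▸ (hb 1 u hu).1) (hq'.symm ▸ (hb 2 u hu).1) hpq
      have h₂ := hL.norm_sub_le (hb 3 u hu).1 hpq
      have h₃ : ‖p‖ ≤ ‖g 0 0 - g 1 0‖ * Real.exp (L * ε) := by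
        rw [hp, norm_sub_rev]
        exact norm_sub_le_of_trajectories hL (hgL 0) (hgL 1) hu'
      have h₄ : ‖q‖ ≤ ‖g 0 0 - g 2 0‖ * Real.exp (L * ε) := by
        rw [hq, norm_sub_rev]
        exact norm_sub_le_of_trajectories hL (hgL 0) (hgL 2) hu'
      have e₁ : g 3 u - (a + p + q) = a - g 1 u - g 2 u + g 3 u := by
        simp only [ha, hp, hq]; abel
      have e₂ : f a - f (g 1 u) - f (g 2 u) + f (g 3 u) =
          (f (g 3 u) - f (a + p + q)) + (f a - f (a + p) - f (a + q) + f (a + p + q)) := by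
        rw [hp', hq']; abel
      rw [e₁] at h₂
      rw [e₂]
      refine (norm_add_le _ _).trans (add_le_add h₂ (h₁.trans ?_))
      rw [hδ]
      gcongr) t (right_mem_Icc.2 ht.1)
  rw [sub_zero] at key
  refine key.trans ((hC δ (by positivity) t ht).trans (le_of_eq ?_))
  rw [hδ]
  ring

end ODE

/-! ### The local flow of a vector field -/

section Flow

variable {n : ℕ} {M : Type*} [TopologicalSpace M] [ChartedSpace (EuclideanSpace ℝ (Fin n)) M]

open Classical in
/-- The maximal flow of a vector field; the value is `x` where the integral curve through `x`
does not extend symmetrically up to time `t`. -/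
noncomputable def maximalFlow (X : ∀ x : M, TangentSpace (𝓡 n) x) (t : ℝ) (x : M) : M :=
  if h : ∃ (γ : ℝ → M) (T : ℝ), |t| < T ∧ γ 0 = x ∧ IsMIntegralCurveOn γ X (Ioo (-T) T)
  then h.choose t else x

/-- The coordinate expression of a vector field in a chart. -/
noncomputable def chartField (X : ∀ x : M, TangentSpace (𝓡 n) x)
    (φ : OpenPartialHomeomorph M (EuclideanSpace ℝ (Fin n))) (y : EuclideanSpace ℝ (Fin n)) :
    EuclideanSpace ℝ (Fin n) :=
  VectorField.mpullback (𝓡 n) (𝓡 n) φ.symm X y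

variable {X : ∀ x : M, TangentSpace (𝓡 n) x}

section Chart

variable {φ : OpenPartialHomeomorph M (EuclideanSpace ℝ (Fin n))}

theorem mdifferentiable_of_mem_maximalAtlas (hφ : φ ∈ IsManifold.maximalAtlas (𝓡 n) ∞ M) :
    φ.MDifferentiable (𝓡 n) (𝓡 n) :=
  ⟨(contMDiffOn_of_mem_maximalAtlas hφ).mdifferentiableOn (by simp),
    (contMDiffOn_symm_of_mem_maximalAtlas hφ).mdifferentiableOn (by simp)⟩

theorem mfderiv_symm_chartField (hφ : φ ∈ IsManifold.maximalAtlas (𝓡 n) ∞ M)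
    {y : EuclideanSpace ℝ (Fin n)} (hy : y ∈ φ.target) :
    mfderiv (𝓡 n) (𝓡 n) φ.symm y (chartField X φ y) = X (φ.symm y) := by
  have hd := (mdifferentiable_of_mem_maximalAtlas hφ).symm
  exact ContinuousLinearMap.IsInvertible.self_apply_inverse ⟨hd.mfderiv hy, rfl⟩ _

theorem hasMFDerivAt_symm_comp (hφ : φ ∈ IsManifold.maximalAtlas (𝓡 n) ∞ M)
    {α : ℝ → EuclideanSpace ℝ (Fin n)} {t : ℝ} (ht : α t ∈ φ.target)
    (h : HasDerivAt α (chartField X φ (α t)) t) :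
    HasMFDerivAt 𝓘(ℝ, ℝ) (𝓡 n) (fun t => φ.symm (α t)) t
      ((1 : ℝ →L[ℝ] ℝ).smulRight (X (φ.symm (α t)))) := by
  have hd := (mdifferentiable_of_mem_maximalAtlas hφ).symm
  have h₁ := (hd.mdifferentiableAt ht).hasMFDerivAt.comp t h.hasFDerivAt.hasMFDerivAt
  refine h₁.congr_mfderiv ?_
  rw [← mfderiv_symm_chartField (X := X) hφ ht]
  ext
  exact (congrArg _ (one_smul ℝ _)).trans (one_smul ℝ _).symm

variable [IsManifold (𝓡 n) ∞ M]

theorem contDiffAt_chartField {k : ℕ}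
    (hX : ContMDiff (𝓡 n) (𝓡 n).tangent k (fun x => (⟨x, X x⟩ : TangentBundle (𝓡 n) M)))
    (hφ : φ ∈ IsManifold.maximalAtlas (𝓡 n) ∞ M)
    {y : EuclideanSpace ℝ (Fin n)} (hy : y ∈ φ.target) :
    ContDiffAt ℝ k (chartField X φ) y := by
  have hd := (mdifferentiable_of_mem_maximalAtlas hφ).symm
  refine contMDiffAt_vectorSpace_iff_contDiffAt.1
    (ContMDiffAt.mpullback_vectorField_preimage (n := ∞) (hX (φ.symm y))
      ((contMDiffOn_symm_of_mem_maximalAtlas hφ).contMDiffAt (φ.open_target.mem_nhds hy))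
      ⟨hd.mfderiv hy, rfl⟩ ?_)
  -- Pulling back differentiates the chart once, so order `k` needs the chart to have order `k + 1`.
  exact_mod_cast (le_top : ((k + 1 : ℕ) : ℕ∞) ≤ ⊤)

end Chart

variable [T2Space M] [IsManifold (𝓡 n) ∞ M]

/-- Two integral curves through `x` agree on the smaller of their intervals, `M` being Hausdorff;
the choice in `maximalFlow` is therefore immaterial. -/
theorem maximalFlow_eq
    (hX : ContMDiff (𝓡 n) (𝓡 n).tangent 1 (fun x => (⟨x, X x⟩ : TangentBundle (𝓡 n) M)))
    {γ : ℝ → M} {x : M} {T t : ℝ} (hγ0 : γ 0 = x) (hγ : IsMIntegralCurveOn γ X (Ioo (-T) T))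
    (ht : |t| < T) : maximalFlow X t x = γ t := by
  have : IsManifold (𝓡 n) 1 M := IsManifold.of_le (n := ∞) (by simp)
  have h : ∃ (γ : ℝ → M) (T : ℝ), |t| < T ∧ γ 0 = x ∧ IsMIntegralCurveOn γ X (Ioo (-T) T) :=
    ⟨γ, T, ht, hγ0, hγ⟩
  rw [maximalFlow, dif_pos h]
  obtain ⟨S, hS, h0, hc⟩ := h.choose_spec
  have hm : |t| < min S T := lt_min hS ht
  have hpos : 0 < min S T := (abs_nonneg t).trans_lt hm
  refine isMIntegralCurveOn_Ioo_eqOn_of_contMDiff_boundaryless (t₀ := 0)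
    (a := -min S T) (b := min S T) ⟨by linarith, hpos⟩ hX
    (hc.mono (Ioo_subset_Ioo (neg_le_neg (min_le_left _ _)) (min_le_left _ _)))
    (hγ.mono (Ioo_subset_Ioo (neg_le_neg (min_le_right _ _)) (min_le_right _ _)))
    (h0.trans hγ0.symm) (abs_lt.1 hm)

theorem maximalFlow_eq_self_of_eq_zero
    (hX : ContMDiff (𝓡 n) (𝓡 n).tangent 1 (fun x => (⟨x, X x⟩ : TangentBundle (𝓡 n) M)))
    {x : M} (hx : X x = 0) (t : ℝ) : maximalFlow X t x = x :=
  maximalFlow_eq (γ := fun _ => x) (T := |t| + 1) hX rfl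
    ((isMIntegralCurve_const hx).isMIntegralCurveOn _) (by linarith)

variable {φ : OpenPartialHomeomorph M (EuclideanSpace ℝ (Fin n))} {p : M}

/-- The bridge from `M` to the chart: near `(0, p)` the flow is the image of ODE trajectories
confined to a prescribed `s`, chosen later as a set on which the coordinate field obeys the bounds
needed. -/
theorem exists_maximalFlow_eq_symm
    (hX : ContMDiff (𝓡 n) (𝓡 n).tangent 1 (fun x => (⟨x, X x⟩ : TangentBundle (𝓡 n) M)))
    (hφ : φ ∈ IsManifold.maximalAtlas (𝓡 n) ∞ M) (hp : p ∈ φ.source)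
    {s : Set (EuclideanSpace ℝ (Fin n))} (hs : s ∈ 𝓝 (φ p)) :
    ∃ r > (0 : ℝ), ∃ ε > (0 : ℝ), ∃ α : EuclideanSpace ℝ (Fin n) → ℝ → EuclideanSpace ℝ (Fin n),
      Metric.ball (φ p) r ⊆ φ.target ∧
      ∀ y ∈ Metric.ball (φ p) r, α y 0 = y ∧
        IsMIntegralCurveOn (fun t => φ.symm (α y t)) X (Ioo (-ε) ε) ∧
        ∀ t ∈ Ioo (-ε) ε, α y t ∈ s ∧ α y t ∈ φ.target ∧
          HasDerivAt (α y) (chartField X φ (α y t)) t ∧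
          maximalFlow X t (φ.symm y) = φ.symm (α y t) := by
  have hpt : φ.target ∈ 𝓝 (φ p) := φ.open_target.mem_nhds (φ.map_source hp)
  obtain ⟨r, hr, ε, hε, H⟩ := exists_trajectories_mem_of_contDiffAt
    (by exact_mod_cast contDiffAt_chartField (k := 1) (by exact_mod_cast hX) hφ (φ.map_source hp))
    (Filter.inter_mem hs hpt)
  obtain ⟨r', hr', hr't⟩ := Metric.mem_nhds_iff.1 hpt
  choose! α hα0 hα using H
  refine ⟨min r r', lt_min hr hr', ε, hε, α,
    (Metric.ball_subset_ball (min_le_right _ _)).trans hr't, fun y hy => ?_⟩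
  replace hy := Metric.ball_subset_ball (min_le_left _ _) hy
  have hc : IsMIntegralCurveOn (fun t => φ.symm (α y t)) X (Ioo (-ε) ε) := fun t ht =>
    (hasMFDerivAt_symm_comp hφ (hα y hy t ht).1.2 (hα y hy t ht).2).hasMFDerivWithinAt
  refine ⟨hα0 y hy, hc, fun t ht => ⟨(hα y hy t ht).1.1, (hα y hy t ht).1.2, (hα y hy t ht).2, ?_⟩⟩
  exact maximalFlow_eq hX (by rw [hα0 y hy]) hc (abs_lt.2 ht)

end Flow

/-! ### Local estimates for the flow of a vector field -/

theorem OpenPartialHomeomorph.eventually_nhds_zero_prod {M H : Type*} [TopologicalSpace M]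
    [PseudoMetricSpace H] {φ : OpenPartialHomeomorph M H} {p : M} (hp : p ∈ φ.source) {r ε : ℝ} (hr : 0 < r) (hε : 0 < ε) :
    ∀ᶠ z : ℝ × M in 𝓝 (0, p),
      z.1 ∈ Ioo (-ε) ε ∧ z.2 ∈ φ.source ∧ φ z.2 ∈ Metric.ball (φ p) r :=
  (Filter.Eventually.prod_inl_nhds (Ioo_mem_nhds (neg_lt_zero.2 hε) hε) p).and
    ((Filter.Eventually.prod_inr_nhds (φ.open_source.mem_nhds hp) 0).and
      (Filter.Eventually.prod_inr_nhds
        ((φ.continuousAt hp).eventually (Metric.ball_mem_nhds _ hr)) 0))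

section FlowEstimates

variable {n : ℕ} {M : Type*} [TopologicalSpace M] [ChartedSpace (EuclideanSpace ℝ (Fin n)) M]
  [T2Space M] [IsManifold (𝓡 n) ∞ M] {X : ∀ x : M, TangentSpace (𝓡 n) x} {p : M}
  {φ : OpenPartialHomeomorph M (EuclideanSpace ℝ (Fin n))}

theorem exists_isLocalFlow {M : Type} [TopologicalSpace M]
    [ChartedSpace (EuclideanSpace ℝ (Fin n)) M] [T2Space M] [IsManifold (𝓡 n) ∞ M]
    {X : ∀ x : M, TangentSpace (𝓡 n) x}
    (hX : ContMDiff (𝓡 n) (𝓡 n).tangent 1 (fun x => (⟨x, X x⟩ : TangentBundle (𝓡 n) M))) (p : M) :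
    ∃ U T Φ, IsLocalFlow X U T Φ ∧ p ∈ U := by
  obtain ⟨r, hr, ε, hε, α, -, hα⟩ := exists_maximalFlow_eq_symm hX
    (IsManifold.chart_mem_maximalAtlas (I := 𝓡 n) p) (mem_chart_source _ p) Filter.univ_mem
  set φ := chartAt (EuclideanSpace ℝ (Fin n)) p
  refine ⟨φ.source ∩ φ ⁻¹' Metric.ball (φ p) r, ε, fun t x => φ.symm (α (φ x) t),
    ⟨φ.isOpen_inter_preimage Metric.isOpen_ball, hε, fun x hx => ?_, fun x hx => (hα _ hx.2).2.1⟩,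
    mem_chart_source _ p, Metric.mem_ball_self hr⟩
  rw [(hα _ hx.2).1, φ.left_inv hx.1]

theorem tendsto_maximalFlow
    (hX : ContMDiff (𝓡 n) (𝓡 n).tangent 1 (fun x => (⟨x, X x⟩ : TangentBundle (𝓡 n) M))) (p : M) :
    Filter.Tendsto (fun z : ℝ × M => maximalFlow X z.1 z.2) (𝓝 (0, p)) (𝓝 p) := by
  intro U hU
  set φ := chartAt (EuclideanSpace ℝ (Fin n)) p
  have hp : p ∈ φ.source := mem_chart_source _ p
  have hs : φ.symm ⁻¹' U ∈ 𝓝 (φ p) := (φ.tendsto_symm hp) hU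
  obtain ⟨r, hr, ε, hε, α, -, hα⟩ := exists_maximalFlow_eq_symm hX
    (IsManifold.chart_mem_maximalAtlas (I := 𝓡 n) p) hp hs
  rw [Filter.mem_map]
  filter_upwards [φ.eventually_nhds_zero_prod hp hr hε] with z ⟨hz₁, hz₂, hz₃⟩
  obtain ⟨h₁, -, -, h₂⟩ := (hα _ hz₃).2.2 _ hz₁
  rw [φ.left_inv hz₂] at h₂
  rw [mem_preimage, h₂]
  exact h₁

theorem exists_abs_comp_maximalFlow_sub_le
    (hX : ContMDiff (𝓡 n) (𝓡 n).tangent 1 (fun x => (⟨x, X x⟩ : TangentBundle (𝓡 n) M))) (p : M)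
    {h : M → ℝ} (hh : ContMDiff (𝓡 n) 𝓘(ℝ, ℝ) ∞ h) :
    ∃ C, ∀ᶠ z : ℝ × M in 𝓝 (0, p), |h (maximalFlow X z.1 z.2) - h z.2| ≤ C * |z.1| := by
  set φ := chartAt (EuclideanSpace ℝ (Fin n)) p
  have hp : p ∈ φ.source := mem_chart_source _ p
  have hφ : φ ∈ IsManifold.maximalAtlas (𝓡 n) ∞ M :=
    IsManifold.chart_mem_maximalAtlas (I := 𝓡 n) p
  have hh' : ContDiffAt ℝ ∞ (h ∘ φ.symm) (φ p) :=
    ((hh (φ.symm (φ p))).comp (φ p) ((contMDiffOn_symm_of_mem_maximalAtlas hφ).contMDiffAt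
      (φ.open_target.mem_nhds (φ.map_source hp)))).contDiffAt
  obtain ⟨K, s, hs, hK⟩ := (hh'.of_le (by simp : (1 : WithTop ℕ∞) ≤ ∞)).exists_lipschitzOnWith
  have hf : ContDiffAt ℝ (1 : ℕ) (chartField X φ) (φ p) :=
    contDiffAt_chartField (by exact_mod_cast hX) hφ (φ.map_source hp)
  -- Confinement to this set bounds the speed of the trajectories; with `h ∘ φ.symm` Lipschitz this
  -- yields a bound linear in time.
  have hB : {y | ‖chartField X φ y‖ < ‖chartField X φ (φ p)‖ + 1} ∈ 𝓝 (φ p) :=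
    hf.continuousAt.norm.eventually_lt_const (lt_add_one _)
  obtain ⟨r, hr, ε, hε, α, -, hα⟩ := exists_maximalFlow_eq_symm hX hφ hp (Filter.inter_mem hs hB)
  refine ⟨K * (‖chartField X φ (φ p)‖ + 1), ?_⟩
  filter_upwards [φ.eventually_nhds_zero_prod hp hr hε] with z ⟨hz₁, hz₂, hz₃⟩
  obtain ⟨h0, -, H⟩ := hα _ hz₃
  have hI : (0 : ℝ) ∈ Ioo (-ε) ε := ⟨neg_lt_zero.2 hε, hε⟩
  have h₂ := (H _ hz₁).2.2.2
  rw [φ.left_inv hz₂] at h₂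
  have h₃ := hK.norm_sub_le (H _ hz₁).1.1 (H _ hI).1.1
  rw [Function.comp_apply, Function.comp_apply, h0, φ.left_inv hz₂, ← h₂] at h₃
  have h₄ := (convex_Ioo (-ε) ε).norm_image_sub_le_of_norm_hasDerivWithin_le
    (fun t ht => (H t ht).2.2.1.hasDerivWithinAt) (fun t ht => (le_of_lt (H t ht).1.2)) hI hz₁
  rw [h0, sub_zero, Real.norm_eq_abs] at h₄
  rw [← Real.norm_eq_abs, mul_assoc]
  exact h₃.trans (mul_le_mul_of_nonneg_left h₄ K.2)

theorem hasDerivAt_comp_maximalFlow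
    (hX : ContMDiff (𝓡 n) (𝓡 n).tangent 1 (fun x => (⟨x, X x⟩ : TangentBundle (𝓡 n) M))) (p : M)
    {h : M → ℝ} (hh : ContMDiff (𝓡 n) 𝓘(ℝ, ℝ) ∞ h) :
    HasDerivAt (fun t => h (maximalFlow X t p)) (mfderiv (𝓡 n) 𝓘(ℝ, ℝ) h p (X p)) 0 ∧
      maximalFlow X 0 p = p := by
  set φ := chartAt (EuclideanSpace ℝ (Fin n)) p
  have hp : p ∈ φ.source := mem_chart_source _ p
  obtain ⟨r, hr, ε, hε, α, -, hα⟩ := exists_maximalFlow_eq_symm hX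
    (IsManifold.chart_mem_maximalAtlas (I := 𝓡 n) p) hp Filter.univ_mem
  obtain ⟨h0, hc, H⟩ := hα _ (Metric.mem_ball_self hr)
  have hI : (0 : ℝ) ∈ Ioo (-ε) ε := ⟨neg_lt_zero.2 hε, hε⟩
  have hγ := (hc 0 hI).hasMFDerivAt (Ioo_mem_nhds hI.1 hI.2)
  have e0 : φ.symm (α (φ p) 0) = p := by rw [h0, φ.left_inv hp]
  have hd := ((hh (φ.symm (α (φ p) 0))).mdifferentiableAt (by simp)).hasMFDerivAt.comp 0 hγ
  have hd' : HasDerivAt (fun t => h (φ.symm (α (φ p) t)))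
      (mfderiv (𝓡 n) 𝓘(ℝ, ℝ) h (φ.symm (α (φ p) 0)) (X (φ.symm (α (φ p) 0)))) 0 := by
    refine hasMFDerivAt_iff_hasFDerivAt.1 (hd.congr_mfderiv ?_)
    refine ContinuousLinearMap.ext_ring ?_
    exact (congrArg _ (one_smul ℝ _)).trans (one_smul ℝ _).symm
  have hΦ : ∀ t ∈ Ioo (-ε) ε, maximalFlow X t p = φ.symm (α (φ p) t) := fun t ht =>
    (congrArg (maximalFlow X t) (φ.left_inv hp).symm).trans (H t ht).2.2.2
  refine ⟨?_, (hΦ 0 hI).trans e0⟩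
  rw [e0] at hd'
  refine hd'.congr_of_eventuallyEq ?_
  filter_upwards [Ioo_mem_nhds hI.1 hI.2] with t ht
  rw [hΦ t ht]

theorem exists_norm_maximalFlow_sub_le
    (hX : ContMDiff (𝓡 n) (𝓡 n).tangent 1 (fun x => (⟨x, X x⟩ : TangentBundle (𝓡 n) M)))
    (hφ : φ ∈ IsManifold.maximalAtlas (𝓡 n) ∞ M) (hp : p ∈ φ.source) :
    ∃ C, ∀ᶠ z : ℝ × (M × M) in 𝓝 (0, (p, p)), 0 ≤ z.1 →
      ‖φ (maximalFlow X z.1 z.2.1) - φ z.2.1 - φ (maximalFlow X z.1 z.2.2) + φ z.2.2‖ ≤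
        C * (z.1 * ‖φ z.2.1 - φ z.2.2‖) := by
  have hf : ContDiffAt ℝ (1 : ℕ) (chartField X φ) (φ p) :=
    contDiffAt_chartField (by exact_mod_cast hX) hφ (φ.map_source hp)
  obtain ⟨K, s, hs, hK⟩ := hf.exists_lipschitzOnWith
  obtain ⟨r, hr, ε, hε, α, -, hα⟩ := exists_maximalFlow_eq_symm hX hφ hp hs
  refine ⟨K * Real.exp (K * ε), ?_⟩
  have hE := φ.eventually_nhds_zero_prod hp hr hε
  have h₁ : Filter.Tendsto (fun z : ℝ × (M × M) => (z.1, z.2.1)) (𝓝 (0, (p, p))) (𝓝 (0, p)) :=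
    Continuous.tendsto (by fun_prop) _
  have h₂ : Filter.Tendsto (fun z : ℝ × (M × M) => (z.1, z.2.2)) (𝓝 (0, (p, p))) (𝓝 (0, p)) :=
    Continuous.tendsto (by fun_prop) _
  filter_upwards [h₁.eventually hE, h₂.eventually hE] with z ⟨hz, ha, ha'⟩ ⟨_, hb, hb'⟩ hz0
  obtain ⟨a0, -, Ha⟩ := hα _ ha'
  obtain ⟨b0, -, Hb⟩ := hα _ hb'
  have key := norm_sub_sub_add_le_of_trajectories hK
    (fun t ht => ⟨(Ha t ht).1, (Ha t ht).2.2.1⟩) (fun t ht => ⟨(Hb t ht).1, (Hb t ht).2.2.1⟩)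
    ⟨hz0, hz.2⟩
  have ea := (Ha _ hz).2.2.2
  have eb := (Hb _ hz).2.2.2
  rw [φ.left_inv ha] at ea
  rw [φ.left_inv hb] at eb
  rw [ea, eb, φ.right_inv (Ha _ hz).2.1, φ.right_inv (Hb _ hz).2.1]
  rwa [a0, b0] at key

theorem exists_norm_second_difference_maximalFlow_le
    (hX : ContMDiff (𝓡 n) (𝓡 n).tangent 2 (fun x => (⟨x, X x⟩ : TangentBundle (𝓡 n) M)))
    (hφ : φ ∈ IsManifold.maximalAtlas (𝓡 n) ∞ M) (hp : p ∈ φ.source)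
    {G : ℝ → EuclideanSpace ℝ (Fin n) → EuclideanSpace ℝ (Fin n)}
    (hG : ∀ t y, G t y = φ (maximalFlow X t (φ.symm y))) :
    ∃ C, ∀ᶠ z : ℝ × (EuclideanSpace ℝ (Fin n) ×
        (EuclideanSpace ℝ (Fin n) × EuclideanSpace ℝ (Fin n))) in 𝓝 (0, (φ p, (0, 0))), 0 ≤ z.1 →
      ‖G z.1 z.2.1 - G z.1 (z.2.1 + z.2.2.1) - G z.1 (z.2.1 + z.2.2.2) +
          G z.1 (z.2.1 + z.2.2.1 + z.2.2.2)‖ ≤ C * (z.1 * ‖z.2.2.1‖ * ‖z.2.2.2‖) := by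
  have hf : ContDiffAt ℝ (2 : ℕ) (chartField X φ) (φ p) :=
    contDiffAt_chartField (by exact_mod_cast hX) hφ (φ.map_source hp)
  have hf' : ContDiffAt ℝ 1 (fderiv ℝ (chartField X φ)) (φ p) :=
    hf.fderiv_right (by norm_num)
  obtain ⟨L, s, hs, hL⟩ := (hf.of_le (m := 1) (by norm_num)).exists_lipschitzOnWith
  obtain ⟨K, s', hs', hK⟩ := hf'.exists_lipschitzOnWith
  obtain ⟨δ, hδ, hδs⟩ := Metric.mem_nhds_iff.1
    (Filter.inter_mem hs (Filter.inter_mem hs' (φ.open_target.mem_nhds (φ.map_source hp))))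
  obtain ⟨r, hr, ε, hε, α, -, hα⟩ := exists_maximalFlow_eq_symm (hX.of_le (by norm_num)) hφ hp
    -- A third of `δ` leaves room for the fourth vertex of the parallelogram.
    (Metric.ball_mem_nhds (φ p) (show 0 < δ / 3 by positivity))
  obtain ⟨C, hC⟩ := exists_second_difference_le_of_trajectories (ε := ε) (y₀ := φ p) (r := δ)
    (hL.mono (hδs.trans inter_subset_left))
    (fun x hx => ((contDiffAt_chartField (k := 2) (by exact_mod_cast hX) hφ
      (hδs hx).2.2).differentiableAt (by norm_num)).hasFDerivAt)
    (hK.mono (hδs.trans (inter_subset_right.trans inter_subset_left)))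
  refine ⟨C, ?_⟩
  have hball : ∀ {g : ℝ × (EuclideanSpace ℝ (Fin n) × (EuclideanSpace ℝ (Fin n) ×
      EuclideanSpace ℝ (Fin n))) → EuclideanSpace ℝ (Fin n)}, Continuous g →
      g (0, (φ p, (0, 0))) = φ p →
      ∀ᶠ z in 𝓝 (0, (φ p, (0, 0))), g z ∈ Metric.ball (φ p) r := fun hg h0 =>
    hg.continuousAt.eventually (by rw [h0]; exact Metric.ball_mem_nhds _ hr)
  filter_upwards [(continuous_fst.continuousAt (x := ((0 : ℝ), (φ p,
        ((0 : EuclideanSpace ℝ (Fin n)), (0 : EuclideanSpace ℝ (Fin n))))))).eventually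
      (Ioo_mem_nhds (neg_lt_zero.2 hε) hε),
    hball (g := fun z => z.2.1) (by fun_prop) rfl,
    hball (g := fun z => z.2.1 + z.2.2.1) (by fun_prop) (by simp),
    hball (g := fun z => z.2.1 + z.2.2.2) (by fun_prop) (by simp),
    hball (g := fun z => z.2.1 + z.2.2.1 + z.2.2.2) (by fun_prop) (by simp)]
    with z hz h₀ h₁ h₂ h₃ hz0
  have hGα : ∀ y ∈ Metric.ball (φ p) r, G z.1 y = α y z.1 := fun y hy => by
    rw [hG, ((hα y hy).2.2 _ hz).2.2.2, φ.right_inv ((hα y hy).2.2 _ hz).2.1]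
  have key := hC ![α z.2.1, α (z.2.1 + z.2.2.1), α (z.2.1 + z.2.2.2),
      α (z.2.1 + z.2.2.1 + z.2.2.2)]
    (fun i t ht => by
      have hi : ∀ y ∈ Metric.ball (φ p) r, α y t ∈ Metric.ball (φ p) (δ / 3) ∧
          HasDerivAt (α y) (chartField X φ (α y t)) t := fun y hy =>
        ⟨((hα y hy).2.2 t ht).1, ((hα y hy).2.2 t ht).2.2.1⟩
      fin_cases i
      exacts [hi _ h₀, hi _ h₁, hi _ h₂, hi _ h₃])
    (by simp [(hα _ h₀).1, (hα _ h₁).1, (hα _ h₂).1, (hα _ h₃).1]; abel) z.1 ⟨hz0, hz.2⟩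
  rw [hGα _ h₀, hGα _ h₁, hGα _ h₂, hGα _ h₃]
  simpa [(hα _ h₀).1, (hα _ h₁).1, (hα _ h₂).1] using key

end FlowEstimates

/-! ### The prevector field given by the flow at infinitesimal time -/

namespace NonstandardExtension

variable (N : NonstandardExtension) {lam : N.star ℝ} {n : ℕ} {M : Type} [TopologicalSpace M]
  [T2Space M] [ChartedSpace (EuclideanSpace ℝ (Fin n)) M] [IsManifold (𝓡 n) ∞ M]
  {X : ∀ x : M, TangentSpace (𝓡 n) x}

theorem isPrevector_maximalFlow (hlam : N.IsPosInfinitesimal lam)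
    (hX : ContMDiff (𝓡 n) (𝓡 n).tangent 1 (fun x => (⟨x, X x⟩ : TangentBundle (𝓡 n) M)))
    {a : N.star M} (ha : a ∈ N.nearstandard M) :
    N.IsPrevector n lam a (N.map₂ (maximalFlow X) lam a) := by
  obtain ⟨p, hp⟩ := mem_iUnion.1 ha
  obtain ⟨z, rfl, rfl⟩ := N.exists_map_fst_snd lam a
  have hz : z ∈ N.halo ((0 : ℝ), p) := N.mem_halo_prod hlam.2 hp
  refine ⟨ha, ?_, fun f hf => ?_⟩
  · rw [map₂_map_map]
    refine N.halo_subset_nearstandard p fun U hU hpU => ?_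
    rw [← mem_starSet_preimage]
    exact N.mem_starSet_of_eventually hz (tendsto_maximalFlow hX p (hU.mem_nhds hpU))
  · obtain ⟨C, hC⟩ := exists_abs_comp_maximalFlow_sub_le hX p hf
    simp only [map₂_map_map, map_map, map_sub_map]
    exact N.prec_map_map (N.mem_starSet_of_eventually hz hC)

/-- Test on a bump function `f` supported in `U` and equal to `1` near `p`: `f` is `1` at `a` and
changes infinitesimally, so it is nonzero at `b`. This lets the estimates near `(p, p)` apply to
prevectors. -/
theorem IsPrevector.mem_halo (hlam : N.IsPosInfinitesimal lam) {a b : N.star M}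
    (hab : N.IsPrevector n lam a b) {p : M} (ha : a ∈ N.halo p) : b ∈ N.halo p := by
  intro U hU hp
  obtain ⟨f, -, hf⟩ := (SmoothBumpFunction.nhds_basis_tsupport (I := 𝓡 n) p).mem_iff.1
    (hU.mem_nhds hp)
  have hd := Prec.mem_halo_zero N (hab.2.2 f f.contMDiff) hlam.2
  obtain ⟨z, rfl, rfl⟩ := N.exists_map_fst_snd a b
  simp only [map_map, map_sub_map] at hd
  have h₁ := N.mem_starSet_of_eventually hd
    (Metric.ball_mem_nhds (0 : ℝ) (show (0 : ℝ) < 1 by norm_num))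
  have h₂ := N.mem_starSet_of_eventually ha f.eventuallyEq_one
  rw [← mem_starSet_preimage] at h₁ h₂
  have h₃ : z ∈ N.starSet _ := (N.starSet_inter _ _).superset ⟨h₁, h₂⟩
  rw [← mem_starSet_preimage]
  refine N.starSet_mono ?_ h₃
  rintro w ⟨hw₁, hw₂⟩
  refine hf (subset_tsupport _ fun h0 => ?_)
  have hw₂' : f w.1 = 1 := hw₂
  have hw₁' : |f w.2 - f w.1| < 1 := by simpa using hw₁
  rw [h0, hw₂'] at hw₁'
  norm_num at hw₁'

theorem starSet_pos {A : Type} {g : A → ℝ} {z : N.star A}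
    (h : N.IsPosInfinitesimal (N.map g z)) : z ∈ N.starSet {a | 0 < g a} :=
  (N.mem_starSet_preimage _ _ _).2 h.1

theorem prec_norm_map {A E : Type} [NormedAddCommGroup E] [TopologicalSpace A] {p : A}
    {z : N.star A} (hz : z ∈ N.halo p) {t : A → ℝ} (ht : N.IsPosInfinitesimal (N.map t z))
    {u : A → E} {v : A → ℝ} {C : ℝ} (h : ∀ᶠ a in 𝓝 p, 0 ≤ t a → ‖u a‖ ≤ C * v a)
    (hv : ∀ a, 0 ≤ t a → 0 ≤ v a) :
    N.Prec (N.map (fun a => ‖u a‖) z) (N.map v z) := by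
  have h' : z ∈ N.starSet _ := (N.starSet_inter _ _).superset
    ⟨N.mem_starSet_of_eventually hz h, N.starSet_pos ht⟩
  refine N.prec_map_map (C := C) (N.starSet_mono ?_ h')
  rintro a ⟨ha, ha'⟩
  have ha₀ : 0 ≤ t a := le_of_lt ha'
  change |‖u a‖| ≤ C * |v a|
  rw [abs_norm, abs_of_nonneg (hv a ha₀)]
  exact ha ha₀

theorem isPrevectorField_maximalFlow (hlam : N.IsPosInfinitesimal lam)
    (hX : ContMDiff (𝓡 n) (𝓡 n).tangent 1 (fun x => (⟨x, X x⟩ : TangentBundle (𝓡 n) M))) :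
    N.IsPrevectorField n lam (N.map₂ (maximalFlow X) lam) :=
  ⟨N.isInternalMap_map₂ _ _, fun _ ha => N.isPrevector_maximalFlow hlam hX ha⟩

theorem isD1_maximalFlow (hlam : N.IsPosInfinitesimal lam)
    (hX : ContMDiff (𝓡 n) (𝓡 n).tangent 1 (fun x => (⟨x, X x⟩ : TangentBundle (𝓡 n) M))) :
    N.IsD1 n lam (N.map₂ (maximalFlow X) lam) := by
  refine ⟨N.isPrevectorField_maximalFlow hlam hX, fun p φ hφ hp a ha b _ hab => ?_⟩
  have hb := IsPrevector.mem_halo N hlam hab ha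
  clear hab
  obtain ⟨C, hC⟩ := exists_norm_maximalFlow_sub_le hX hφ hp
  obtain ⟨y, rfl, rfl⟩ := N.exists_map_fst_snd a b
  obtain ⟨z, rfl, rfl⟩ := N.exists_map_fst_snd lam y
  have hz : z ∈ N.halo ((0 : ℝ), (p, p)) := N.mem_halo_prod hlam.2 (N.mem_halo_prod ha hb)
  simp only [map_map, map₂_map_map, map_sub_map, map_add_map, norm_map, map_mul_map]
  exact N.prec_norm_map hz hlam hC fun w hw => mul_nonneg hw (norm_nonneg _)

theorem isD2_maximalFlow (hlam : N.IsPosInfinitesimal lam)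
    (hX : ContMDiff (𝓡 n) (𝓡 n).tangent 2 (fun x => (⟨x, X x⟩ : TangentBundle (𝓡 n) M))) :
    N.IsD2 n lam (N.map₂ (maximalFlow X) lam) := by
  refine ⟨N.isPrevectorField_maximalFlow hlam (hX.of_le (by norm_num)),
    fun p φ hφ hp a ha v w hv hw => ?_⟩
  obtain ⟨C, hC⟩ := exists_norm_second_difference_maximalFlow_le hX hφ hp (fun _ _ => rfl)
  have hx := N.map_mem_halo ha (φ.continuousAt hp)
  replace hv := N.mem_halo_zero_of_norm (Prec.mem_halo_zero N hv hlam.2)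
  replace hw := N.mem_halo_zero_of_norm (Prec.mem_halo_zero N hw hlam.2)
  intro x G
  change x ∈ _ at hx
  clear_value x
  obtain ⟨y, rfl, rfl⟩ := N.exists_map_fst_snd v w
  obtain ⟨y, rfl, rfl⟩ := N.exists_map_fst_snd x y
  obtain ⟨z, rfl, rfl⟩ := N.exists_map_fst_snd lam y
  have hz : z ∈ N.halo ((0 : ℝ), (φ p, ((0 : EuclideanSpace ℝ (Fin n)),
      (0 : EuclideanSpace ℝ (Fin n))))) :=
    N.mem_halo_prod hlam.2 (N.mem_halo_prod hx (N.mem_halo_prod hv hw))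
  simp only [G, map_map, map₂_map_map, map_sub_map, map_add_map, norm_map, map_mul_map]
  exact N.prec_norm_map hz hlam hC fun w hw =>
    mul_nonneg (mul_nonneg hw (norm_nonneg _)) (norm_nonneg _)

theorem realizes_maximalFlow (hlam : N.IsPosInfinitesimal lam)
    (hX : ContMDiff (𝓡 n) (𝓡 n).tangent 1 (fun x => (⟨x, X x⟩ : TangentBundle (𝓡 n) M))) :
    N.Realizes lam (N.map₂ (maximalFlow X) lam) X := by
  intro p h hh U hU hp
  obtain ⟨hd, h0⟩ := hasDerivAt_comp_maximalFlow hX p hh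
  have ht := hasDerivAt_iff_tendsto_slope_zero.1 hd
  have hev := eventually_nhdsWithin_iff.1 (ht (hU.mem_nhds hp))
  -- `lam` is infinitesimal and positive, hence nonzero, so the limit of real difference quotients
  -- transfers to it.
  have hmem : lam ∈ N.starSet _ := (N.starSet_inter _ _).superset
    ⟨N.mem_starSet_of_eventually hlam.2 hev, hlam.1⟩
  -- Writing `lam` through the identity and `std p` through a constant map makes every term a map of
  -- the same `z`.
  obtain ⟨z, rfl⟩ : ∃ z, lam = N.map (fun t : ℝ => t) z := ⟨lam, (N.map_id _ _).symm⟩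
  rw [← N.map_const p z]
  simp only [map_map, map₂_map_map, map_sub_map, map_div_map]
  rw [← mem_starSet_preimage] at hmem ⊢
  refine N.starSet_mono ?_ hmem
  rintro t ⟨ht₁, ht₂⟩
  have := ht₁ (ne_of_gt ht₂)
  simpa only [mem_preimage, zero_add, h0, smul_eq_mul, div_eq_inv_mul] using this

theorem map₂_maximalFlow_eq (hlam : N.IsPosInfinitesimal lam)
    (hX : ContMDiff (𝓡 n) (𝓡 n).tangent 1 (fun x => (⟨x, X x⟩ : TangentBundle (𝓡 n) M)))
    {p : M} {a : N.star M} (ha : a ∈ N.halo p) {U : Set M} {T : ℝ} {Φ : ℝ → M → M}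
    (hΦ : IsLocalFlow X U T Φ) (hp : p ∈ U) :
    N.map₂ (maximalFlow X) lam a = N.map₂ Φ lam a := by
  obtain ⟨z, rfl, rfl⟩ := N.exists_map_fst_snd lam a
  have hz : z ∈ N.halo ((0 : ℝ), p) := N.mem_halo_prod hlam.2 ha
  rw [map₂_map_map, map₂_map_map]
  have hev : ∀ᶠ w : ℝ × M in 𝓝 (0, p), w.1 ∈ Ioo (-T) T ∧ w.2 ∈ U :=
    (Filter.Eventually.prod_inl_nhds (Ioo_mem_nhds (neg_lt_zero.2 hΦ.pos) hΦ.pos) p).and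
      (Filter.Eventually.prod_inr_nhds (hΦ.isOpen.mem_nhds hp) 0)
  exact N.map_congr_of_mem (N.mem_starSet_of_eventually hz hev) fun w hw =>
    maximalFlow_eq hX (hΦ.zero _ hw.2) (hΦ.integralCurve _ hw.2) (abs_lt.2 hw.1)

theorem isCanonicalOnNearstandard_maximalFlow (hlam : N.IsPosInfinitesimal lam)
    (hX : ContMDiff (𝓡 n) (𝓡 n).tangent 1 (fun x => (⟨x, X x⟩ : TangentBundle (𝓡 n) M))) :
    N.IsCanonicalOnNearstandard lam X (N.map₂ (maximalFlow X) lam) := fun p _ ha =>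
  ⟨exists_isLocalFlow hX p, fun _ _ _ hΦ hp => N.map₂_maximalFlow_eq hlam hX ha hΦ hp⟩

theorem map₂_maximalFlow_eq_self
    (hX : ContMDiff (𝓡 n) (𝓡 n).tangent 1 (fun x => (⟨x, X x⟩ : TangentBundle (𝓡 n) M)))
    (hK : IsCompact (closure {x : M | X x ≠ 0})) {a : N.star M} (ha : a ∉ N.nearstandard M) :
    N.map₂ (maximalFlow X) lam a = a := by
  have haK := (N.mem_starSet_compl_iff _ _).2
    fun h => ha (N.starSet_subset_nearstandard_of_isCompact hK h)
  obtain ⟨z, rfl, rfl⟩ := N.exists_map_fst_snd lam a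
  rw [map₂_map_map]
  refine N.map_congr_of_mem ((N.mem_starSet_preimage _ _ _).2 haK) fun w hw => ?_
  exact maximalFlow_eq_self_of_eq_zero hX (by_contra fun h => hw (subset_closure h)) _

end NonstandardExtension

/-! ### Existence, and uniqueness for compact support -/

theorem mainTheorem1 (N : NonstandardExtension) (lam : N.star ℝ) (hlam : N.IsPosInfinitesimal lam)
    (n : ℕ) (M : Type) [TopologicalSpace M] [T2Space M] [SecondCountableTopology M]
    [ChartedSpace (EuclideanSpace ℝ (Fin n)) M] [IsManifold (𝓡 n) ∞ M]
    (X : ∀ x : M, TangentSpace (𝓡 n) x)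
    (hX : ContMDiff (𝓡 n) (𝓡 n).tangent 1 (fun x => (⟨x, X x⟩ : TangentBundle (𝓡 n) M))) :
    (N.CountablySaturated →
      ∃ F : N.star M → N.star M,
        N.IsD1 n lam F ∧
        (ContMDiff (𝓡 n) (𝓡 n).tangent 2 (fun x => (⟨x, X x⟩ : TangentBundle (𝓡 n) M)) →
          N.IsD2 n lam F) ∧
        N.Realizes lam F X ∧
        N.IsCanonicalOnNearstandard lam X F) ∧
    (IsCompact (closure {x : M | X x ≠ 0}) →
      ∃! F : N.star M → N.star M,
        N.IsD1 n lam F ∧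
        (ContMDiff (𝓡 n) (𝓡 n).tangent 2 (fun x => (⟨x, X x⟩ : TangentBundle (𝓡 n) M)) →
          N.IsD2 n lam F) ∧
        N.Realizes lam F X ∧
        N.IsCanonicalOnNearstandard lam X F ∧
        ∀ a, a ∉ N.nearstandard M → F a = a) := by
  refine ⟨fun _ => ⟨N.map₂ (maximalFlow X) lam, N.isD1_maximalFlow hlam hX,
    fun hX₂ => N.isD2_maximalFlow hlam hX₂, N.realizes_maximalFlow hlam hX,
    N.isCanonicalOnNearstandard_maximalFlow hlam hX⟩,
    fun hK => ⟨N.map₂ (maximalFlow X) lam, ⟨N.isD1_maximalFlow hlam hX,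
      fun hX₂ => N.isD2_maximalFlow hlam hX₂, N.realizes_maximalFlow hlam hX,
      N.isCanonicalOnNearstandard_maximalFlow hlam hX,
      fun a ha => N.map₂_maximalFlow_eq_self hX hK ha⟩, ?_⟩⟩
  rintro F ⟨-, -, -, hF, hF'⟩
  funext a
  by_cases ha : a ∈ N.nearstandard M
  · obtain ⟨p, hp⟩ := mem_iUnion.1 ha
    obtain ⟨⟨U, T, Φ, hΦ, hpU⟩, h⟩ := hF p a hp
    rw [h U T Φ hΦ hpU, N.map₂_maximalFlow_eq hlam hX hp hΦ hpU]
  · rw [hF' a ha, N.map₂_maximalFlow_eq_self hX hK ha]
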